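/- Let $G=(V,E,\{w_e\}_{e\in E})$ be a finite connected weighted graph with $|V|\ge 2$: $(V,E)$ is a finite connected simple graph and $w_e>0$ for every edge $e\in E$. For $e=\{a,b\}\in E$ let $f_e:V\to V$ be the transposition exchanging $a$ and $b$. Let $\mathrm{RW}(G)$ be the continuous-time Markov chain on $V$ that jumps from $u$ to $v\neq u$ at rate $w_e$ if $v=f_e(u)$ for some $e\in E$ (and at rate $0$ otherwise). Let $\mathrm{IP}(2,G)$, the two-particle interchange process, be the continuous-time Markov chain on the set $(V)_2$ of ordered pairs of distinct vertices that jumps from $(x_1,x_2)$ to $(y_1,y_2)\neq(x_1,x_2)$ at rate $w_e$ if $(y_1,y_2)=(f_e(x_1),f_e(x_2))$ for some $e\in E$ (and at rate $0$ otherwise). For a continuous-time Markov chain $Q$ on a finite set $S$ with transition probabilities $q_t(s,s')$ and stationary distribution $\pi$, and $\varepsilon\in(0,1)$, let $$T_Q(\varepsilon)=\inf\Big\{t\ge 0:\ \max_{s\in S} d_{TV}(q_t(s,\cdot),\pi)\le \varepsilon\Big\},\qquad d_{TV}(\mu,\nu)=\max_{A\subseteq S}(\mu(A)-\nu(A)),$$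 be its $\varepsilon$-mixing time. Then $T_{\mathrm{RW}(G)}(1/4)$ is finite and $$T_{\mathrm{IP}(2,G)}(1/4)\le 20000\,T_{\mathrm{RW}(G)}(1/4).$$ -/

import Mathlib

open scoped NNReal ENNReal

noncomputable section

/-! ### Continuous-time Markov chains on a finite set -/

/-- The generator of the continuous-time Markov chain on the finite set `S` with transition rates
`q s s'` for `s ≠ s'` (the values `q s s` are irrelevant):
`(Q f)(s) = ∑_{s' ≠ s} q(s,s') (f(s') - f(s))`, written as a matrix. -/
def generator {S : Type*} [Fintype S] [DecidableEq S] (q : S → S → ℝ) : Matrix S S ℝ :=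
  Matrix.of fun s s' => if s = s' then -∑ u ∈ Finset.univ.erase s, q s u else q s s'

/-- The transition probabilities `q_t(s,s') = P(X_t = s' | X_0 = s)` of the chain with rates `q`:
the transition semigroup `exp (t Q)` generated by `Q`. -/
def transitionProb {S : Type*} [Fintype S] [DecidableEq S] (q : S → S → ℝ) (t : ℝ≥0) :
    Matrix S S ℝ :=
  NormedSpace.exp ((t : ℝ) • generator q)

/-- `π` is a stationary (equilibrium) probability distribution of the chain with rates `q`:
started from `π`, the chain has law `π` at all times. -/
structure IsStationaryDist {S : Type*} [Fintype S] [DecidableEq S] (q : S → S → ℝ) (π : S → ℝ) :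
    Prop where
  nonneg : ∀ s, 0 ≤ π s
  sum_eq_one : ∑ s, π s = 1
  invariant : ∀ (t : ℝ≥0) (s' : S), ∑ s, π s * transitionProb q t s s' = π s'

/-- Total variation distance of two distributions on a finite set:
`max_{A ⊆ S} (μ(A) - ν(A))`. -/
def tvDist {S : Type*} (μ ν : S → ℝ) : ℝ :=
  ⨆ A : Finset S, (∑ s ∈ A, μ s - ∑ s ∈ A, ν s)

/-- The `ε`-mixing time
`inf {t ≥ 0 : max_s d_TV(q_t(s,·), π) ≤ ε}` of the chain with rates `q` and stationary
distribution `π`, as an element of `[0,∞]` (so that the infimum of the empty set is `∞`). -/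
def mixingTime {S : Type*} [Fintype S] [DecidableEq S] (q : S → S → ℝ) (π : S → ℝ) (ε : ℝ) :
    ℝ≥0∞ :=
  ⨅ (t : ℝ≥0) (_ : ∀ s, tvDist (fun s' => transitionProb q t s s') π ≤ ε), (t : ℝ≥0∞)

/-! ### Weighted graphs, random walk and interchange process -/

/-- A weighted graph `(V, E, {w_e}_{e ∈ E})` with vertex set `V`: every edge has a positive
weight. -/
structure WeightedGraph (V : Type*) where
  graph : SimpleGraph V
  weight : graph.edgeSet → ℝ
  weight_pos : ∀ e, 0 < weight e

/-- The transposition `f_e` exchanging the two endpoints of `e`. -/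
def edgeSwap {V : Type*} [DecidableEq V] (e : Sym2 V) : Equiv.Perm V :=
  Sym2.lift ⟨fun a b => Equiv.swap a b, fun a b => Equiv.swap_comm a b⟩ e

open Classical in
/-- Transition rates of the random walk `RW(G)` on `V`: `q(u,v) = w_e` if `f_e(u) = v` and `0` if
there is no such edge `e`. For `u ≠ v` at most one edge contributes to the sum. -/
def WeightedGraph.rwRate {V : Type*} [Fintype V] [DecidableEq V] (G : WeightedGraph V)
    (u v : V) : ℝ :=
  ∑ e : G.graph.edgeSet, if edgeSwap (e : Sym2 V) u = v then G.weight e else 0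

open Classical in
/-- Transition rates of the `k`-particle interchange process `IP(k,G)` on the set `(V)_k` of
`k`-tuples of distinct vertices (injections `Fin k ↪ V`): `q(x,y) = w_e` if
`(f_e(x(1)),…,f_e(x(k))) = y` and `0` if there is no such edge `e`. For `x ≠ y` at most one edge
contributes to the sum. -/
def WeightedGraph.ipRate {V : Type*} [Fintype V] [DecidableEq V] (G : WeightedGraph V) (k : ℕ)
    (x y : Fin k ↪ V) : ℝ :=
  ∑ e : G.graph.edgeSet,
    if x.trans (edgeSwap (e : Sym2 V)).toEmbedding = y then G.weight e else 0

end

/-! Mixing is measured by the oscillation of the semigroup on functions with values in [0,1].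
Distance 1/4 to equilibrium at time t makes the walk contract oscillations by 1/2
(`OscContracts.of_tvDist`). Contraction by 1/4 for the interchange process gives distance 1/4 back
(`OscContracts.tvDist_le`). Contraction factors multiply over successive times, so constants are
amplified freely.

Let τ = 6t and let m be the probability that two independent walks meet within time τ (`meetProb`).
The proof splits on the chance that independent walks, after running freely for τ, meet in the next
τ. If this chance is at least 2/5 from some pair, mixing makes it nearly as large from every pair,
so independent walks meet quickly. Interchange processes differing in one coordinate couple at such
a meeting (`heat_ipGen_sub_le_of_triple`), and at most three changes of one coordinate join any two
states. If it is below 2/5 from every pair, let the interchange process run for τ. Since m is a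
positive semidefinite kernel (`posKernel_meetProb`), Liggett's inequality (`heat_ipGen_le_prodHeat`)
bounds its expected m by 2/5 as well. From then on the process agrees with independent walks up to
an error m (`prodHeat_sub_meetProb_le`), and these are already mixed.

No coupling is constructed: each comparison is a differential inequality, checked at a negative
minimum by `nonneg_of_deriv_nonneg_at_min`. -/

/-! ### A maximum principle for finite systems of differential equations -/

/-- If, at every time, each negative minimal coordinate has nonnegative derivative, then a
differentiable finite family of functions that starts nonnegative stays nonnegative. -/
theorem nonneg_of_deriv_nonneg_at_min {S : Type*} [Finite S] {u u' : ℝ → S → ℝ}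
    (hd : ∀ t s, HasDerivAt (fun r => u r s) (u' t s) t) (h0 : ∀ s, 0 ≤ u 0 s)
    (hmin : ∀ t, 0 ≤ t → ∀ s, (∀ s', u t s ≤ u t s') → u t s < 0 → 0 ≤ u' t s)
    {t : ℝ} (ht : 0 ≤ t) (s : S) : 0 ≤ u t s := by
  by_contra! hneg
  obtain ⟨ε, hε, hεt⟩ : ∃ ε > 0, u t s + ε * (1 + t) ≤ 0 := by
    refine ⟨-u t s / (1 + t), by apply div_pos <;> linarith, ?_⟩
    rw [div_mul_cancel₀ _ (by linarith)]; linarith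
  -- The tilt makes the derivative at a negative minimum at least ε > 0. At the first time `t₀` when
  -- some coordinate of `v` is nonpositive, the minimal one would have been nonpositive slightly
  -- earlier. The tilt does not depend on `s`, so `u` and `v` have the same minimizers.
  set v : ℝ → S → ℝ := fun r s => u r s + ε * (1 + r) with hv
  have hvd : ∀ r s, HasDerivAt (fun r => v r s) (u' r s + ε) r := by
    intro r s
    have h1 : HasDerivAt (fun r : ℝ => ε * (1 + r)) ε r := by
      simpa using ((hasDerivAt_id r).const_add 1).const_mul ε
    exact (hd r s).add h1
  have hvc : ∀ s, Continuous (fun r => v r s) := fun s =>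
    continuous_iff_continuousAt.2 fun r => (hvd r s).continuousAt
  set C : Set ℝ := Set.Icc 0 t ∩ ⋃ s, {r | v r s ≤ 0} with hC
  have hCc : IsCompact C := isCompact_Icc.inter_right
    (isClosed_iUnion_of_finite fun s => isClosed_le (hvc s) continuous_const)
  have hCne : C.Nonempty := ⟨t, ⟨ht, le_rfl⟩, Set.mem_iUnion.2 ⟨s, hεt⟩⟩
  have hmem := hCc.sInf_mem hCne
  set t₀ := sInf C
  obtain ⟨⟨ht0, ht0t⟩, hU⟩ := hmem
  obtain ⟨s₁, hs₁⟩ := Set.mem_iUnion.1 hU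
  have : Nonempty S := ⟨s⟩
  obtain ⟨s₀, hs₀⟩ := Finite.exists_min (u t₀)
  have hv0 : v t₀ s₀ ≤ 0 := by
    have := hs₀ s₁
    change v t₀ s₁ ≤ 0 at hs₁
    simp only [hv] at hs₁ ⊢
    linarith
  have hpos : 0 < t₀ := by
    rcases ht0.lt_or_eq with h | h
    · exact h
    · exfalso
      have := h0 s₀
      rw [← h] at hv0
      simp only [hv] at hv0
      linarith
  have hlt : u t₀ s₀ < 0 := by
    have : 0 < ε * (1 + t₀) := by positivity
    simp only [hv] at hv0
    linarith
  have hder := hmin t₀ ht0 s₀ hs₀ hlt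
  have hev := (hasDerivAt_iff_tendsto_slope_left_right.1 (hvd t₀ s₀)).1
  have hev2 : ∀ᶠ r in nhdsWithin t₀ (Set.Iio t₀), 0 < slope (fun r => v r s₀) t₀ r :=
    hev.eventually (lt_mem_nhds (by linarith))
  have hev3 : ∀ᶠ r in nhdsWithin t₀ (Set.Iio t₀), r ∈ Set.Ioo 0 t₀ := Ioo_mem_nhdsLT hpos
  obtain ⟨r, hr1, hr2⟩ := (hev2.and hev3).exists
  have hrv : v r s₀ ≤ 0 := by
    rw [slope_def_field] at hr1
    have h3 : r - t₀ < 0 := by linarith [hr2.2]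
    have h4 := (div_pos_iff.1 hr1)
    rcases h4 with h4 | h4 <;> linarith [h4.1, h4.2]
  have : t₀ ≤ r := csInf_le hCc.bddBelow
    ⟨⟨hr2.1.le, by linarith [hr2.2]⟩, Set.mem_iUnion.2 ⟨s₀, hrv⟩⟩
  linarith [hr2.2]

/-! ### The flow of a matrix -/

section Heat

variable {S : Type*} [Fintype S] [DecidableEq S]

/-- The solution at time `t` of `u' = M u`, `u(0) = g`. -/
noncomputable def heat (M : Matrix S S ℝ) (t : ℝ) (g : S → ℝ) : S → ℝ :=
  (NormedSpace.exp (t • M)).mulVec g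

theorem heat_apply (M : Matrix S S ℝ) (t : ℝ) (g : S → ℝ) (s : S) :
    heat M t g s = ∑ s', NormedSpace.exp (t • M) s s' * g s' := rfl

@[simp] theorem heat_zero (M : Matrix S S ℝ) (g : S → ℝ) : heat M 0 g = g := by
  simp [heat]

theorem heat_add_time (M : Matrix S S ℝ) (t r : ℝ) (g : S → ℝ) :
    heat M (t + r) g = heat M t (heat M r g) := by
  rw [heat, heat, heat, Matrix.mulVec_mulVec, add_smul, Matrix.exp_add_of_commute]
  exact ((Commute.refl M).smul_left t).smul_right r

theorem heat_sub (M : Matrix S S ℝ) (t : ℝ) (g h : S → ℝ) :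
    heat M t (g - h) = heat M t g - heat M t h := Matrix.mulVec_sub _ _ _

theorem heat_smul (M : Matrix S S ℝ) (t c : ℝ) (g : S → ℝ) :
    heat M t (c • g) = c • heat M t g := Matrix.mulVec_smul _ _ _

theorem hasDerivAt_exp_apply (M : Matrix S S ℝ) (t : ℝ) (s s' : S) :
    HasDerivAt (fun r : ℝ => NormedSpace.exp (r • M) s s')
      ((M * NormedSpace.exp (t • M)) s s') t := by
  open scoped Matrix.Norms.Operator in
  have h := hasDerivAt_exp_smul_const' (𝕂 := ℝ) M t
  exact (hasDerivAt_pi.1 ((hasDerivAt_pi.1 h) s)) s'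

theorem hasDerivAt_exp_apply' (M : Matrix S S ℝ) (t : ℝ) (s s' : S) :
    HasDerivAt (fun r : ℝ => NormedSpace.exp (r • M) s s')
      ((NormedSpace.exp (t • M) * M) s s') t := by
  open scoped Matrix.Norms.Operator in
  have h := hasDerivAt_exp_smul_const (𝕂 := ℝ) M t
  exact (hasDerivAt_pi.1 ((hasDerivAt_pi.1 h) s)) s'

theorem hasDerivAt_heat (M : Matrix S S ℝ) (g : S → ℝ) (t : ℝ) (s : S) :
    HasDerivAt (fun r => heat M r g s) (M.mulVec (heat M t g) s) t := by
  have h : HasDerivAt (fun r : ℝ => ∑ s', NormedSpace.exp (r • M) s s' * g s')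
      (∑ s', (M * NormedSpace.exp (t • M)) s s' * g s') t :=
    HasDerivAt.fun_sum fun s' _ => (hasDerivAt_exp_apply M t s s').mul_const (g s')
  rw [heat, Matrix.mulVec_mulVec]
  exact h

theorem generator_mulVec (q : S → S → ℝ) (g : S → ℝ) (s : S) :
    (generator q).mulVec g s = ∑ s', q s s' * (g s' - g s) := by
  simp only [Matrix.mulVec, dotProduct, generator, Matrix.of_apply]
  rw [← Finset.add_sum_erase _ _ (Finset.mem_univ s), ← Finset.add_sum_erase _ _ (Finset.mem_univ s)]
  have h : ∀ u ∈ Finset.univ.erase s,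
      (if s = u then -∑ u ∈ Finset.univ.erase s, q s u else q s u) * g u = q s u * g u := by
    intro u hu
    rw [if_neg (Finset.ne_of_mem_erase hu).symm]
  rw [Finset.sum_congr rfl h, if_pos rfl, neg_mul, Finset.sum_mul]
  simp only [mul_sub, Finset.sum_sub_distrib, sub_self]
  ring

/-- The flow of `M` has the minimum principle: at a minimum of `g`, `M g` is nonnegative. -/
def MinPrinciple (M : Matrix S S ℝ) : Prop :=
  ∀ (g : S → ℝ) (s : S), (∀ s', g s ≤ g s') → 0 ≤ M.mulVec g s

theorem minPrinciple_generator {q : S → S → ℝ} (hq : ∀ s s', 0 ≤ q s s') :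
    MinPrinciple (generator q) := fun g s hs => by
  rw [generator_mulVec]
  exact Finset.sum_nonneg fun s' _ => mul_nonneg (hq _ _) (sub_nonneg.2 (hs s'))

namespace MinPrinciple

variable {M : Matrix S S ℝ}

theorem le_heat (hM : MinPrinciple M) {g : S → ℝ} {c : ℝ} (hg : ∀ s, c ≤ g s) {t : ℝ}
    (ht : 0 ≤ t) (s : S) : c ≤ heat M t g s := by
  have := nonneg_of_deriv_nonneg_at_min (u := fun t s => heat M t g s - c)
    (fun t s => (hasDerivAt_heat M g t s).sub_const c) (by simpa using hg)
    (fun t _ s hs _ => hM _ s fun s' => by linarith [hs s']) ht s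
  linarith

theorem heat_le (hM : MinPrinciple M) {g : S → ℝ} {c : ℝ} (hg : ∀ s, g s ≤ c) {t : ℝ}
    (ht : 0 ≤ t) (s : S) : heat M t g s ≤ c := by
  have := hM.le_heat (g := (-1 : ℝ) • g) (c := -c) (by simpa using hg) ht s
  rw [heat_smul] at this
  simp at this
  linarith

theorem heat_const (hM : MinPrinciple M) (c : ℝ) {t : ℝ} (ht : 0 ≤ t) (s : S) :
    heat M t (fun _ => c) s = c :=
  le_antisymm (hM.heat_le (fun _ => le_rfl) ht s) (hM.le_heat (fun _ => le_rfl) ht s)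

theorem heat_mono (hM : MinPrinciple M) {g h : S → ℝ} (hgh : ∀ s, g s ≤ h s) {t : ℝ}
    (ht : 0 ≤ t) (s : S) : heat M t g s ≤ heat M t h s := by
  have := hM.le_heat (g := h - g) (c := 0) (fun s => sub_nonneg.2 (hgh s)) ht s
  rw [heat_sub] at this
  simpa using this

theorem heat_const_sub (hM : MinPrinciple M) (c : ℝ) (g : S → ℝ) {t : ℝ} (ht : 0 ≤ t) (s : S) :
    heat M t (fun s => c - g s) s = c - heat M t g s := by
  have := congrFun (heat_sub M t (fun _ => c) g) s
  rw [Pi.sub_apply, hM.heat_const c ht] at this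
  exact this

/-- The flow intertwines with maps that intertwine the matrices. -/
theorem heat_comp (hM : MinPrinciple M) {S' : Type*} [Fintype S'] [DecidableEq S']
    {M' : Matrix S' S' ℝ} (φ : S → S')
    (hφ : ∀ g s, M.mulVec (g ∘ φ) s = M'.mulVec g (φ s)) (g : S' → ℝ) {t : ℝ} (ht : 0 ≤ t) (s : S) :
    heat M t (g ∘ φ) s = heat M' t g (φ s) := by
  -- One inequality for every `g` suffices; the other is this one for `-g`.
  have key : ∀ g : S' → ℝ, heat M' t g (φ s) ≤ heat M t (g ∘ φ) s := by
    intro g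
    have := nonneg_of_deriv_nonneg_at_min
      (u := fun t s => heat M t (g ∘ φ) s - heat M' t g (φ s))
      (fun t s => (hasDerivAt_heat M _ t s).sub (hasDerivAt_heat M' _ t (φ s))) (by simp)
      (fun t _ s hs _ => by
        rw [← hφ, ← Pi.sub_apply, ← Matrix.mulVec_sub]
        exact hM _ s hs) ht s
    linarith
  refine le_antisymm ?_ (key g)
  have := key ((-1 : ℝ) • g)
  rw [show ((-1 : ℝ) • g) ∘ φ = (-1 : ℝ) • (g ∘ φ) from rfl, heat_smul, heat_smul] at this
  simpa using this

end MinPrinciple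

/-! ### Contraction of oscillations -/

/-- The flow of `M` up to time `t` maps functions with values in `[0,1]` to functions with
oscillation at most `c`. -/
def OscContracts (M : Matrix S S ℝ) (t c : ℝ) : Prop :=
  ∀ g : S → ℝ, (∀ s, 0 ≤ g s) → (∀ s, g s ≤ 1) → ∀ x y, heat M t g x - heat M t g y ≤ c

namespace OscContracts

variable {M : Matrix S S ℝ} {t r c d : ℝ}

/-- Affine rescaling to values in [0,1]; zero oscillation is separate because the rescaling divides
by `m`. -/
theorem of_osc_le (hM : MinPrinciple M) (ht : 0 ≤ t) (h : OscContracts M t c) {m : ℝ}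
    {g : S → ℝ} (hg : ∀ x y, g x - g y ≤ m) (x y : S) :
    heat M t g x - heat M t g y ≤ c * m := by
  have : Nonempty S := ⟨x⟩
  obtain ⟨z, hz⟩ := Finite.exists_min g
  have hm : 0 ≤ m := by simpa using hg x x
  rcases hm.eq_or_lt with rfl | hm
  · have h1 := hM.heat_le (g := g) (c := g z) (fun s => by linarith [hg s z]) ht x
    have h2 := hM.le_heat hz ht y
    rw [mul_zero]
    linarith
  · have h1 := h (fun s => m⁻¹ * (g s - g z))
      (fun s => mul_nonneg (inv_nonneg.2 hm.le) (sub_nonneg.2 (hz s)))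
      (fun s => by rw [inv_mul_le_iff₀ hm]; linarith [hg s z]) x y
    have h2 : ∀ x, heat M t (fun s => m⁻¹ * (g s - g z)) x = m⁻¹ * (heat M t g x - g z) := by
      intro x
      have h3 := congrFun (heat_smul M t m⁻¹ (g - fun _ => g z)) x
      rw [heat_sub, Pi.smul_apply, Pi.sub_apply, hM.heat_const _ ht] at h3
      exact h3
    rw [h2, h2, ← mul_sub, inv_mul_le_iff₀ hm] at h1
    linarith

theorem add (hM : MinPrinciple M) (ht : 0 ≤ t) (h : OscContracts M t c)
    (h' : OscContracts M r d) : OscContracts M (t + r) (c * d) := fun g g0 g1 x y => by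
  rw [heat_add_time]
  exact h.of_osc_le hM ht (h' g g0 g1) x y

theorem pow (hM : MinPrinciple M) (ht : 0 ≤ t) (h : OscContracts M t c) (n : ℕ) :
    OscContracts M (n * t) (c ^ n) := by
  induction n with
  | zero =>
    intro g g0 g1 x y
    simp only [Nat.cast_zero, zero_mul, heat_zero, pow_zero]
    linarith [g0 y, g1 x]
  | succ n ih =>
    have := h.add hM ht ih
    rwa [pow_succ', Nat.cast_succ, add_one_mul, add_comm _ t]

theorem mono (h : OscContracts M t c) (hcd : c ≤ d) : OscContracts M t d :=
  fun g g0 g1 x y => (h g g0 g1 x y).trans hcd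

/-- A lower bound for one of `g`, `1 - g` bounds the oscillation. -/
theorem of_lower_bound (hM : MinPrinciple M) (ht : 0 ≤ t)
    (h : ∀ g : S → ℝ, (∀ s, 0 ≤ g s) → (∀ s, g s ≤ 1) →
      (∀ x, 1 - c ≤ heat M t g x) ∨ (∀ x, 1 - c ≤ heat M t (fun s => 1 - g s) x)) :
    OscContracts M t c := fun g g0 g1 x y => by
  have h1 := hM.heat_le g1 ht x
  have h0 := hM.le_heat g0 ht y
  rcases h g g0 g1 with h | h
  · linarith [h y]
  · have := h x
    rw [hM.heat_const_sub _ _ ht] at this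
    linarith

end OscContracts

end Heat

/-! ### Total variation and oscillation -/

section Mixing

variable {S : Type*} [Fintype S] [DecidableEq S]

theorem sub_le_tvDist {S : Type*} [Fintype S] (μ ν : S → ℝ) (A : Finset S) :
    ∑ s ∈ A, μ s - ∑ s ∈ A, ν s ≤ tvDist μ ν :=
  le_ciSup (f := fun A : Finset S => ∑ s ∈ A, μ s - ∑ s ∈ A, ν s)
    (Set.finite_range _).bddAbove A

theorem heat_generator_eq (q : S → S → ℝ) (t : ℝ≥0) (g : S → ℝ) (s : S) :
    heat (generator q) t g s = ∑ s', transitionProb q t s s' * g s' := rfl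

theorem sum_transitionProb {q : S → S → ℝ} (hM : MinPrinciple (generator q)) (t : ℝ≥0) (s : S) :
    ∑ s', transitionProb q t s s' = 1 := by
  have := hM.heat_const 1 t.2 s
  simpa [heat_generator_eq q t] using this

theorem OscContracts.of_tvDist {q : S → S → ℝ} (hM : MinPrinciple (generator q)) {π : S → ℝ}
    (hπ : ∑ s, π s = 1) {t : ℝ≥0} {ε : ℝ}
    (h : ∀ s, tvDist (fun s' => transitionProb q t s s') π ≤ ε) :
    OscContracts (generator q) t (2 * ε) := fun g g0 g1 x y => by
  set P := transitionProb q t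
  -- P(x,A) − P(y,A) is the sum of P(x,A) − π(A) and P(y,Aᶜ) − π(Aᶜ), each at most ε.
  set A := Finset.univ.filter fun s => P y s < P x s
  have h1 := (sub_le_tvDist (fun s' => P x s') π A).trans (h x)
  have h2 := (sub_le_tvDist (fun s' => P y s') π Aᶜ).trans (h y)
  have e1 := Finset.sum_add_sum_compl A π
  have e2 := Finset.sum_add_sum_compl A (fun s => P y s)
  rw [sum_transitionProb hM] at e2
  have h3 : heat (generator q) t g x - heat (generator q) t g y
      ≤ ∑ s ∈ A, P x s - ∑ s ∈ A, P y s := by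
    rw [heat_generator_eq, heat_generator_eq, ← Finset.sum_sub_distrib, ← Finset.sum_sub_distrib,
      Finset.sum_filter]
    refine Finset.sum_le_sum fun s _ => ?_
    rw [← sub_mul]
    split_ifs with hs
    · exact mul_le_of_le_one_right (by linarith) (g1 s)
    · exact mul_nonpos_of_nonpos_of_nonneg (by linarith) (g0 s)
  linarith

/-- By stationarity π(A) is the π-average of x ↦ P(x,A), whose values differ from P(s,A) by at most
the oscillation. -/
theorem OscContracts.tvDist_le {q : S → S → ℝ} {π : S → ℝ}
    (hπ : IsStationaryDist q π) {t : ℝ≥0} {ε : ℝ} (h : OscContracts (generator q) t ε) (s : S) :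
    tvDist (fun s' => transitionProb q t s s') π ≤ ε := by
  refine ciSup_le fun A => ?_
  set g : S → ℝ := fun s => if s ∈ A then 1 else 0
  have hg : ∀ x, heat (generator q) t g x = ∑ s ∈ A, transitionProb q t x s := by
    intro x
    simp [heat_generator_eq, g]
  have h1 : ∑ s ∈ A, π s = ∑ x, π x * heat (generator q) t g x := by
    simp_rw [hg, Finset.mul_sum]
    rw [Finset.sum_comm]
    exact Finset.sum_congr rfl fun s' _ => (hπ.invariant t s').symm
  rw [h1, ← hg, ← one_mul (heat _ _ _ s), ← hπ.sum_eq_one, Finset.sum_mul,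
    ← Finset.sum_sub_distrib, ← one_mul ε, ← hπ.sum_eq_one, Finset.sum_mul]
  refine Finset.sum_le_sum fun y _ => ?_
  rw [← mul_sub]
  refine mul_le_mul_of_nonneg_left (h g ?_ ?_ s y) (hπ.nonneg y) <;>
  · intro s; simp only [g]; split_ifs <;> norm_num

theorem OscContracts.mixingTime_le {q : S → S → ℝ} {π : S → ℝ}
    (hπ : IsStationaryDist q π) {t : ℝ≥0} {ε : ℝ} (h : OscContracts (generator q) t ε) :
    mixingTime q π ε ≤ t :=
  iInf₂_le t fun s => h.tvDist_le hπ s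

end Mixing

/-! ### Two independent copies of a flow, and the flow absorbed on the diagonal -/

section Pairs

variable {V : Type*} [Fintype V] [DecidableEq V]

/-- The semigroup of two independent copies of the flow of `M`. -/
noncomputable def prodHeat (M : Matrix V V ℝ) (t : ℝ) (g : V × V → ℝ) (p : V × V) : ℝ :=
  ∑ a, ∑ b, NormedSpace.exp (t • M) p.1 a * NormedSpace.exp (t • M) p.2 b * g (a, b)

/-- The generator of two independent copies of the flow of `M`. -/
def prodGen (M : Matrix V V ℝ) (g : V × V → ℝ) (p : V × V) : ℝ :=
  M.mulVec (fun a => g (a, p.2)) p.1 + M.mulVec (fun b => g (p.1, b)) p.2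

theorem prodHeat_eq_left (M : Matrix V V ℝ) (t : ℝ) (g : V × V → ℝ) (p : V × V) :
    prodHeat M t g p = heat M t (fun a => heat M t (fun b => g (a, b)) p.2) p.1 := by
  simp only [prodHeat, heat_apply, Finset.mul_sum, mul_assoc]

theorem prodHeat_eq_right (M : Matrix V V ℝ) (t : ℝ) (g : V × V → ℝ) (p : V × V) :
    prodHeat M t g p = heat M t (fun b => heat M t (fun a => g (a, b)) p.1) p.2 := by
  simp only [prodHeat, heat_apply, Finset.mul_sum]
  rw [Finset.sum_comm]
  exact Finset.sum_congr rfl fun a _ => Finset.sum_congr rfl fun b _ => by ring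

@[simp] theorem prodHeat_zero (M : Matrix V V ℝ) (g : V × V → ℝ) : prodHeat M 0 g = g := by
  ext p
  simp [prodHeat_eq_left]

theorem prodGen_sub {V : Type*} [Fintype V] (M : Matrix V V ℝ) (g h : V × V → ℝ) (p : V × V) :
    prodGen M (g - h) p = prodGen M g p - prodGen M h p := by
  have h1 := congrFun (Matrix.mulVec_sub M (fun a => g (a, p.2)) (fun a => h (a, p.2))) p.1
  have h2 := congrFun (Matrix.mulVec_sub M (fun b => g (p.1, b)) (fun b => h (p.1, b))) p.2
  simp only [Pi.sub_apply] at h1 h2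
  simp only [prodGen, Pi.sub_apply]
  rw [show (fun a => g (a, p.2) - h (a, p.2)) = (fun a => g (a, p.2)) - fun a => h (a, p.2) from rfl,
    show (fun b => g (p.1, b) - h (p.1, b)) = (fun b => g (p.1, b)) - fun b => h (p.1, b) from rfl,
    h1, h2]
  ring

theorem prodGen_nonneg {V : Type*} [Fintype V] {M : Matrix V V ℝ} (hM : MinPrinciple M) {g : V × V → ℝ} {p : V × V}
    (hp : ∀ p', g p ≤ g p') : 0 ≤ prodGen M g p :=
  add_nonneg (hM (fun a => g (a, p.2)) p.1 fun a => hp (a, p.2))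
    (hM (fun b => g (p.1, b)) p.2 fun b => hp (p.1, b))

theorem hasDerivAt_prodHeat (M : Matrix V V ℝ) (g : V × V → ℝ) (t : ℝ) (p : V × V) :
    HasDerivAt (fun r => prodHeat M r g p) (prodGen M (prodHeat M t g) p) t := by
  have h : HasDerivAt (fun r => prodHeat M r g p)
      (∑ a, ∑ b, ((M * NormedSpace.exp (t • M)) p.1 a * NormedSpace.exp (t • M) p.2 b +
        NormedSpace.exp (t • M) p.1 a * (M * NormedSpace.exp (t • M)) p.2 b) * g (a, b)) t :=
    HasDerivAt.fun_sum fun a _ => HasDerivAt.fun_sum fun b _ =>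
      ((hasDerivAt_exp_apply M t p.1 a).mul (hasDerivAt_exp_apply M t p.2 b)).mul_const _
  convert h using 1
  have h1 : (fun a => prodHeat M t g (a, p.2)) =
      heat M t (fun a => heat M t (fun b => g (a, b)) p.2) :=
    funext fun a => prodHeat_eq_left M t g (a, p.2)
  have h2 : (fun b => prodHeat M t g (p.1, b)) =
      heat M t (fun b => heat M t (fun a => g (a, b)) p.1) :=
    funext fun b => prodHeat_eq_right M t g (p.1, b)
  rw [prodGen, h1, h2, heat, heat, Matrix.mulVec_mulVec, Matrix.mulVec_mulVec]
  simp only [Matrix.mulVec, dotProduct, heat_apply, add_mul, Finset.sum_add_distrib,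
    Finset.mul_sum]
  rw [Finset.sum_comm (f := fun i j => (M * NormedSpace.exp (t • M)) p.2 i * _)]
  congr 1 <;> exact Finset.sum_congr rfl fun a _ => Finset.sum_congr rfl fun b _ => by ring

theorem MinPrinciple.prodHeat_le {M : Matrix V V ℝ} (hM : MinPrinciple M) {g : V × V → ℝ} {c : ℝ}
    (hg : ∀ p, g p ≤ c) {t : ℝ} (ht : 0 ≤ t) (p : V × V) : prodHeat M t g p ≤ c := by
  rw [prodHeat_eq_left]
  exact hM.heat_le (fun a => hM.heat_le (fun b => hg (a, b)) ht _) ht _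

theorem MinPrinciple.prodHeat_const_sub {M : Matrix V V ℝ} (hM : MinPrinciple M) (c : ℝ)
    (g : V × V → ℝ) {t : ℝ} (ht : 0 ≤ t) (p : V × V) :
    prodHeat M t (fun p => c - g p) p = c - prodHeat M t g p := by
  simp only [prodHeat_eq_left, hM.heat_const_sub _ _ ht]

/-- The starting points are changed one coordinate at a time, each at cost `c`. -/
theorem OscContracts.prodHeat_sub_le {M : Matrix V V ℝ} (hM : MinPrinciple M) {t c : ℝ}
    (ht : 0 ≤ t) (h : OscContracts M t c) {g : V × V → ℝ} (g0 : ∀ p, 0 ≤ g p) (g1 : ∀ p, g p ≤ 1)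
    (p q : V × V) : prodHeat M t g p - prodHeat M t g q ≤ 2 * c := by
  have h1 := h (fun a => heat M t (fun b => g (a, b)) p.2)
    (fun a => hM.le_heat (fun b => g0 (a, b)) ht _)
    (fun a => hM.heat_le (fun b => g1 (a, b)) ht _) p.1 q.1
  have h2 := h (fun b => heat M t (fun a => g (a, b)) q.1)
    (fun b => hM.le_heat (fun a => g0 (a, b)) ht _)
    (fun b => hM.heat_le (fun a => g1 (a, b)) ht _) p.2 q.2
  rw [← prodHeat_eq_left M t g p, ← prodHeat_eq_left M t g (q.1, p.2)] at h1
  rw [← prodHeat_eq_right M t g (q.1, p.2), ← prodHeat_eq_right M t g q] at h2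
  linarith

/-- The generator of two independent copies of the flow of `M`, stopped when they meet. -/
def absorbGen (M : Matrix V V ℝ) : Matrix (V × V) (V × V) ℝ :=
  Matrix.of fun p q => if p.1 = p.2 then 0 else
    M p.1 q.1 * (if p.2 = q.2 then 1 else 0) + (if p.1 = q.1 then 1 else 0) * M p.2 q.2

theorem absorbGen_mulVec_diag (M : Matrix V V ℝ) (g : V × V → ℝ) {p : V × V} (hp : p.1 = p.2) :
    (absorbGen M).mulVec g p = 0 := by
  simp [absorbGen, Matrix.mulVec, dotProduct, hp]

theorem absorbGen_mulVec (M : Matrix V V ℝ) (g : V × V → ℝ) {p : V × V} (hp : p.1 ≠ p.2) :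
    (absorbGen M).mulVec g p = prodGen M g p := by
  simp only [absorbGen, Matrix.mulVec, dotProduct, Matrix.of_apply, if_neg hp, prodGen,
    Fintype.sum_prod_type, add_mul, Finset.sum_add_distrib]
  congr 1
  · simp
  · rw [Finset.sum_comm]
    simp

theorem MinPrinciple.absorbed {M : Matrix V V ℝ} (hM : MinPrinciple M) :
    MinPrinciple (absorbGen M) := fun g p hp => by
  by_cases h : p.1 = p.2
  · rw [absorbGen_mulVec_diag M g h]
  · rw [absorbGen_mulVec M g h]
    exact prodGen_nonneg hM hp

/-! ### Meeting probabilities -/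

/-- The probability that two independent copies of the chain meet before time `t`. -/
noncomputable def meetProb (M : Matrix V V ℝ) (t : ℝ) : V × V → ℝ :=
  heat (absorbGen M) t fun p => if p.1 = p.2 then 1 else 0

theorem meetProb_zero (M : Matrix V V ℝ) (p : V × V) :
    meetProb M 0 p = if p.1 = p.2 then 1 else 0 := by simp [meetProb]

theorem meetProb_add (M : Matrix V V ℝ) (t r : ℝ) :
    meetProb M (t + r) = heat (absorbGen M) t (meetProb M r) := heat_add_time _ _ _ _

theorem hasDerivAt_meetProb (M : Matrix V V ℝ) (t : ℝ) (p : V × V) :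
    HasDerivAt (fun r => meetProb M r p) ((absorbGen M).mulVec (meetProb M t) p) t :=
  hasDerivAt_heat _ _ _ _

theorem meetProb_diag (M : Matrix V V ℝ) (t : ℝ) (x : V) : meetProb M t (x, x) = 1 := by
  have h : ∀ r, HasDerivAt (fun r => meetProb M r (x, x)) 0 r := fun r => by
    have := hasDerivAt_meetProb M r (x, x)
    rwa [absorbGen_mulVec_diag M _ rfl] at this
  have := is_const_of_deriv_eq_zero (fun r => (h r).differentiableAt) (fun r => (h r).deriv) t 0
  rw [this, meetProb_zero, if_pos rfl]

namespace MinPrinciple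

variable {M : Matrix V V ℝ}

theorem meetProb_nonneg (hM : MinPrinciple M) {t : ℝ} (ht : 0 ≤ t) (p : V × V) :
    0 ≤ meetProb M t p :=
  hM.absorbed.le_heat (fun p => by split_ifs <;> norm_num) ht p

theorem meetProb_le_one (hM : MinPrinciple M) {t : ℝ} (ht : 0 ≤ t) (p : V × V) :
    meetProb M t p ≤ 1 :=
  hM.absorbed.heat_le (fun p => by split_ifs <;> norm_num) ht p

/-- Meeting during [t, t + r] is one way of meeting before t + r. The two generators differ only on
the diagonal, where `meetProb` is 1, so a negative minimum lies off it. -/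
theorem prodHeat_meetProb_le (hM : MinPrinciple M) {t r : ℝ} (ht : 0 ≤ t) (hr : 0 ≤ r)
    (p : V × V) : prodHeat M t (meetProb M r) p ≤ meetProb M (t + r) p := by
  have := nonneg_of_deriv_nonneg_at_min
    (u := fun t p => heat (absorbGen M) t (meetProb M r) p - prodHeat M t (meetProb M r) p)
    (fun t p => (hasDerivAt_heat _ _ t p).sub (hasDerivAt_prodHeat M _ t p)) (by simp)
    (fun t ht p hp hneg => by
      have hne : p.1 ≠ p.2 := fun h => by
        obtain ⟨x, y⟩ := p
        obtain rfl : x = y := h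
        rw [← meetProb_add, meetProb_diag] at hneg
        linarith [hM.prodHeat_le (hM.meetProb_le_one hr) ht (x, x)]
      rw [absorbGen_mulVec M _ hne, ← prodGen_sub]
      exact prodGen_nonneg hM hp) ht p
  rw [meetProb_add]
  linarith

/-- Markov property at time `t`: the chance of not meeting during the last `r` is at most κ off the
diagonal and 0 on it. -/
theorem one_sub_meetProb_add_le (hM : MinPrinciple M) {t r κ : ℝ} (ht : 0 ≤ t)
    (hκ : ∀ p, 1 - meetProb M r p ≤ κ) (p : V × V) :
    1 - meetProb M (t + r) p ≤ κ * (1 - meetProb M t p) := by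
  have h := hM.absorbed.heat_mono (g := fun p => (1 - κ) - -κ * if p.1 = p.2 then 1 else 0)
    (h := meetProb M r) (fun p => by
      split_ifs with h
      · obtain ⟨x, y⟩ := p
        obtain rfl : x = y := h
        rw [meetProb_diag]
        linarith
      · linarith [hκ p]) ht p
  rw [hM.absorbed.heat_const_sub _ _ ht, ← meetProb_add] at h
  have h2 := congrFun (heat_smul (absorbGen M) t (-κ)
    (fun p : V × V => if p.1 = p.2 then (1 : ℝ) else 0)) p
  have h3 : heat (absorbGen M) t (fun p => -κ * if p.1 = p.2 then (1 : ℝ) else 0) p =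
    -κ * meetProb M t p := h2
  rw [h3] at h
  linarith

theorem one_sub_meetProb_mul_le (hM : MinPrinciple M) {r κ : ℝ} (hr : 0 ≤ r)
    (hκ : ∀ p, 1 - meetProb M r p ≤ κ) (n : ℕ) (p : V × V) :
    1 - meetProb M (n * r) p ≤ κ ^ n := by
  have hκ0 : 0 ≤ κ := by
    have := hκ (p.1, p.1)
    rw [meetProb_diag] at this
    linarith
  induction n with
  | zero =>
    have := hM.meetProb_nonneg le_rfl p
    simpa using this
  | succ n ih =>
    have h := hM.one_sub_meetProb_add_le (t := n * r) (by positivity) hκ p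
    rw [Nat.cast_succ, add_one_mul, pow_succ']
    exact h.trans (mul_le_mul_of_nonneg_left ih hκ0)

end MinPrinciple

/-! ### Positive semidefinite kernels -/

/-- The quadratic form with kernel `g` is nonnegative. -/
def PosKernel {V : Type*} [Fintype V] (g : V × V → ℝ) : Prop :=
  ∀ f : V → ℝ, 0 ≤ ∑ x, ∑ y, f x * f y * g (x, y)

/-- The form of `prodHeat M t g` at `f` is that of `g` at f·exp(tM). -/
theorem PosKernel.posKernel_prodHeat {g : V × V → ℝ} (hg : PosKernel g) (M : Matrix V V ℝ) (t : ℝ) :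
    PosKernel (prodHeat M t g) := fun f => by
  have h := hg (Matrix.vecMul f (NormedSpace.exp (t • M)))
  convert h using 1
  calc ∑ x, ∑ y, f x * f y * prodHeat M t g (x, y)
      = ∑ x, ∑ y, ∑ a, ∑ b, f x * NormedSpace.exp (t • M) x a *
          (f y * NormedSpace.exp (t • M) y b) * g (a, b) := by
        simp only [prodHeat, Finset.mul_sum]
        exact Finset.sum_congr rfl fun x _ => Finset.sum_congr rfl fun y _ =>
          Finset.sum_congr rfl fun a _ => Finset.sum_congr rfl fun b _ => by ring
    _ = ∑ a, ∑ b, ∑ x, ∑ y, f x * NormedSpace.exp (t • M) x a *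
          (f y * NormedSpace.exp (t • M) y b) * g (a, b) := by
        rw [Finset.sum_congr rfl fun x _ => Finset.sum_comm, Finset.sum_comm]
        refine Finset.sum_congr rfl fun a _ => ?_
        rw [Finset.sum_congr rfl fun x _ => Finset.sum_comm, Finset.sum_comm]
    _ = _ := by
        refine Finset.sum_congr rfl fun a _ => Finset.sum_congr rfl fun b _ => ?_
        simp only [Matrix.vecMul, dotProduct]
        rw [Finset.sum_mul_sum, Finset.sum_mul]
        exact Finset.sum_congr rfl fun x _ => by rw [Finset.sum_mul]

theorem PosKernel.sub_apply_nonneg {g : V × V → ℝ} (hg : PosKernel g) (x y : V) :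
    0 ≤ g (x, x) + g (y, y) - g (x, y) - g (y, x) := by
  have h := hg (Pi.single x 1 - Pi.single y 1)
  simp only [Pi.sub_apply, sub_mul, mul_sub, Finset.sum_sub_distrib, Pi.single_apply,
    ite_mul, mul_ite, one_mul, mul_one, zero_mul, mul_zero, Finset.sum_ite_eq', Finset.mem_univ,
    if_true] at h
  linarith

/-- The meeting probability of two independent copies is a positive semidefinite kernel. -/
theorem MinPrinciple.posKernel_meetProb {M : Matrix V V ℝ} (hM : MinPrinciple M) {t : ℝ}
    (ht : 0 ≤ t) : PosKernel (meetProb M t) := fun f => by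
  -- Interpolation: `φ r` uses free flow for time t − r and absorbed flow for time r. Thus `φ t` is
  -- the form in question and `φ 0` is a sum of squares.
  set p : ℝ → V → ℝ := fun r => Matrix.vecMul f (NormedSpace.exp ((t - r) • M)) with hp
  have hpd : ∀ r a, HasDerivAt (fun r => p r a) (-(Matrix.vecMul (p r) M a)) r := by
    intro r a
    have h1 : HasDerivAt (fun r : ℝ => t - r) (-1) r := by
      simpa using (hasDerivAt_id r).const_sub t
    have h2 : ∀ x, HasDerivAt (fun r : ℝ => f x * NormedSpace.exp ((t - r) • M) x a)
        (f x * ((NormedSpace.exp ((t - r) • M) * M) x a * -1)) r := fun x =>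
      ((hasDerivAt_exp_apply' M (t - r) x a).comp r h1).const_mul (f x)
    have h3 := HasDerivAt.fun_sum (u := Finset.univ) fun x _ => h2 x
    have h4 : -(Matrix.vecMul (p r) M a) =
        ∑ x, f x * ((NormedSpace.exp ((t - r) • M) * M) x a * -1) := by
      simp only [hp, Matrix.vecMul_vecMul]
      simp [Matrix.vecMul, dotProduct]
    rw [h4]
    exact h3
  set φ : ℝ → ℝ := fun r => ∑ a, ∑ b, p r a * p r b * meetProb M r (a, b) with hφ
  have hφd : ∀ r, HasDerivAt φ (∑ a, ∑ b, ((-(Matrix.vecMul (p r) M a) * p r b +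
      p r a * -(Matrix.vecMul (p r) M b)) * meetProb M r (a, b) +
      p r a * p r b * (absorbGen M).mulVec (meetProb M r) (a, b))) r := fun r =>
    HasDerivAt.fun_sum fun a _ => HasDerivAt.fun_sum fun b _ =>
      ((hpd r a).mul (hpd r b)).mul (hasDerivAt_meetProb M r (a, b))
  have hgen : ∀ r, ∑ a, ∑ b, (-(Matrix.vecMul (p r) M a) * p r b +
      p r a * -(Matrix.vecMul (p r) M b)) * meetProb M r (a, b) =
      -∑ a, ∑ b, p r a * p r b * prodGen M (meetProb M r) (a, b) := by
    intro r
    have e1 : ∑ a, ∑ b, Matrix.vecMul (p r) M a * p r b * meetProb M r (a, b) =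
        ∑ a, ∑ b, p r a * p r b * M.mulVec (fun a' => meetProb M r (a', b)) a := by
      rw [Finset.sum_comm, Finset.sum_comm (f := fun a b => p r a * p r b * _)]
      refine Finset.sum_congr rfl fun b _ => ?_
      have := Matrix.dotProduct_mulVec (p r) M (fun a' => meetProb M r (a', b))
      simp only [dotProduct] at this
      calc _ = p r b * ∑ a, Matrix.vecMul (p r) M a * meetProb M r (a, b) := by
            rw [Finset.mul_sum]; exact Finset.sum_congr rfl fun a _ => by ring
        _ = _ := by
            rw [← this, Finset.mul_sum]; exact Finset.sum_congr rfl fun a _ => by ring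
    have e2 : ∑ a, ∑ b, p r a * Matrix.vecMul (p r) M b * meetProb M r (a, b) =
        ∑ a, ∑ b, p r a * p r b * M.mulVec (fun b' => meetProb M r (a, b')) b := by
      refine Finset.sum_congr rfl fun a _ => ?_
      have := Matrix.dotProduct_mulVec (p r) M (fun b' => meetProb M r (a, b'))
      simp only [dotProduct] at this
      calc _ = p r a * ∑ b, Matrix.vecMul (p r) M b * meetProb M r (a, b) := by
            rw [Finset.mul_sum]; exact Finset.sum_congr rfl fun b _ => by ring
        _ = _ := by
            rw [← this, Finset.mul_sum]; exact Finset.sum_congr rfl fun b _ => by ring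
    simp only [prodGen, mul_add, Finset.sum_add_distrib, add_mul, ← e1, ← e2, neg_mul, mul_neg,
      Finset.sum_neg_distrib]
    ring
  -- In the derivative of φ the free and absorbed generators cancel off the diagonal. At (a,a) there
  -- remains p(a)² times minus the free generator of `meetProb`, nonnegative because `meetProb`
  -- attains its maximum 1 there.
  have hmono : MonotoneOn φ (Set.Icc 0 t) := by
    refine monotoneOn_of_deriv_nonneg (convex_Icc 0 t)
      (fun r _ => (hφd r).continuousAt.continuousWithinAt)
      (fun r _ => (hφd r).differentiableAt.differentiableWithinAt) fun r hr => ?_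
    rw [interior_Icc] at hr
    rw [(hφd r).deriv]
    simp only [Finset.sum_add_distrib]
    rw [hgen r, neg_add_eq_sub, ← Finset.sum_sub_distrib]
    refine Finset.sum_nonneg fun a _ => ?_
    rw [← Finset.sum_sub_distrib]
    refine Finset.sum_nonneg fun b _ => ?_
    rw [← mul_sub]
    by_cases hab : a = b
    · subst hab
      rw [absorbGen_mulVec_diag M _ rfl]
      refine mul_nonneg (mul_self_nonneg _) ?_
      have h0 := prodGen_nonneg hM (g := fun q => -meetProb M r q) (p := (a, a)) fun q => by
        simp only [meetProb_diag]
        linarith [hM.meetProb_le_one hr.1.le q]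
      have h1 := prodGen_sub M 0 (meetProb M r) (a, a)
      rw [show (0 : V × V → ℝ) - meetProb M r = fun q => -meetProb M r q by ext; simp] at h1
      rw [h1] at h0
      have h2 : prodGen M (0 : V × V → ℝ) (a, a) = 0 := by
        simp [prodGen, Matrix.mulVec, dotProduct]
      linarith
    · rw [absorbGen_mulVec M _ hab]
      simp
  have h0t := hmono (Set.left_mem_Icc.2 ht) (Set.right_mem_Icc.2 ht) ht
  have ht' : φ t = ∑ x, ∑ y, f x * f y * meetProb M t (x, y) := by
    simp [hφ, hp]
  have h0' : 0 ≤ φ 0 := by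
    simp only [hφ, meetProb_zero, mul_ite, mul_one, mul_zero, Finset.sum_ite_eq, Finset.mem_univ,
      if_true]
    exact Finset.sum_nonneg fun a _ => mul_self_nonneg _
  linarith

end Pairs

/-! ### Random walk and interchange process as swap dynamics -/

/-- Splits every generator comparison below: an edge that fixes `x` or `y` moves the pair as one of
two independent walks would, so only the edge joining `x` and `y` needs an argument. -/
theorem edgeSwap_cases {V : Type*} [DecidableEq V] (e : Sym2 V) {x y : V} (hxy : x ≠ y) :
    (edgeSwap e x = y ∧ edgeSwap e y = x ∧ ∀ z, z ≠ x → z ≠ y → edgeSwap e z = z) ∨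
      edgeSwap e x = x ∨ edgeSwap e y = y := by
  induction e using Sym2.ind with
  | _ a b =>
    change (Equiv.swap a b x = y ∧ Equiv.swap a b y = x ∧ ∀ z, z ≠ x → z ≠ y →
      Equiv.swap a b z = z) ∨ Equiv.swap a b x = x ∨ Equiv.swap a b y = y
    simp only [Equiv.swap_apply_def]
    grind

namespace WeightedGraph

section EdgeSum

variable {V : Type*} [Fintype V] (G : WeightedGraph V)

open Classical in
/-- The weighted sum of a function over the edges. -/
noncomputable def edgeSum (F : Sym2 V → ℝ) : ℝ :=
  ∑ e : G.graph.edgeSet, G.weight e * F e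

theorem edgeSum_nonneg {F : Sym2 V → ℝ} (hF : ∀ e, 0 ≤ F e) : 0 ≤ G.edgeSum F :=
  Finset.sum_nonneg fun e _ => mul_nonneg (G.weight_pos e).le (hF e)

theorem edgeSum_sub (F F' : Sym2 V → ℝ) :
    G.edgeSum (fun e => F e - F' e) = G.edgeSum F - G.edgeSum F' := by
  simp [edgeSum, mul_sub]

theorem edgeSum_neg (F : Sym2 V → ℝ) : G.edgeSum (fun e => -F e) = -G.edgeSum F := by
  simp [edgeSum]

theorem edgeSum_add (F F' : Sym2 V → ℝ) :
    G.edgeSum (fun e => F e + F' e) = G.edgeSum F + G.edgeSum F' := by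
  simp [edgeSum, mul_add, Finset.sum_add_distrib]

open Classical in
theorem eq_zero_of_edgeSum_eq_zero {F : Sym2 V → ℝ} (hF : ∀ e, 0 ≤ F e) (h : G.edgeSum F = 0)
    {e : Sym2 V} (he : e ∈ G.graph.edgeSet) : F e = 0 := by
  have := (Finset.sum_eq_zero_iff_of_nonneg fun e _ =>
    mul_nonneg (G.weight_pos e).le (hF e)).1 h ⟨e, he⟩ (Finset.mem_univ _)
  exact (mul_eq_zero.1 this).resolve_left (G.weight_pos ⟨e, he⟩).ne'

end EdgeSum

variable {V : Type*} [Fintype V] [DecidableEq V] (G : WeightedGraph V)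

/-- The action of the transposition along an edge on `k`-tuples. -/
def moveTuple {V : Type*} [DecidableEq V] {k : ℕ} (e : Sym2 V) (x : Fin k ↪ V) : Fin k ↪ V :=
  x.trans (edgeSwap e).toEmbedding

@[simp] theorem moveTuple_apply {V : Type*} [DecidableEq V] {k : ℕ} (e : Sym2 V) (x : Fin k ↪ V)
    (i : Fin k) : moveTuple e x i = edgeSwap e (x i) := rfl

theorem rwRate_nonneg (u v : V) : 0 ≤ G.rwRate u v :=
  Finset.sum_nonneg fun e _ => by split_ifs; exacts [(G.weight_pos e).le, le_rfl]

theorem ipRate_nonneg (k : ℕ) (x y : Fin k ↪ V) : 0 ≤ G.ipRate k x y :=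
  Finset.sum_nonneg fun e _ => by split_ifs; exacts [(G.weight_pos e).le, le_rfl]

/-- The generator of the random walk. -/
noncomputable abbrev rwGen : Matrix V V ℝ := generator G.rwRate

/-- The generator of the `k`-particle interchange process. -/
noncomputable abbrev ipGen (k : ℕ) : Matrix (Fin k ↪ V) (Fin k ↪ V) ℝ := generator (G.ipRate k)

theorem minPrinciple_rwGen : MinPrinciple G.rwGen := minPrinciple_generator G.rwRate_nonneg

theorem minPrinciple_ipGen (k : ℕ) : MinPrinciple (G.ipGen k) :=
  minPrinciple_generator (G.ipRate_nonneg k)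

theorem rwGen_mulVec (g : V → ℝ) (x : V) :
    G.rwGen.mulVec g x = G.edgeSum fun e => g (edgeSwap e x) - g x := by
  rw [generator_mulVec]
  simp only [rwRate, edgeSum, Finset.sum_mul]
  rw [Finset.sum_comm]
  refine Finset.sum_congr rfl fun e _ => ?_
  simp

theorem ipGen_mulVec {k : ℕ} (g : (Fin k ↪ V) → ℝ) (x : Fin k ↪ V) :
    (G.ipGen k).mulVec g x = G.edgeSum fun e => g (moveTuple e x) - g x := by
  rw [generator_mulVec]
  simp only [ipRate, edgeSum, Finset.sum_mul]
  rw [Finset.sum_comm]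
  refine Finset.sum_congr rfl fun e _ => ?_
  simp [moveTuple]

theorem prodGen_rwGen (g : V × V → ℝ) (p : V × V) :
    prodGen G.rwGen g p =
      G.edgeSum fun e => g (edgeSwap e p.1, p.2) + g (p.1, edgeSwap e p.2) - 2 * g p := by
  rw [prodGen, rwGen_mulVec, rwGen_mulVec, ← edgeSum_add]
  congr 1
  ext e
  ring

/-! ### Comparison of the interchange process with independent walks -/

/-- Liggett's inequality for positive semidefinite kernels. -/
theorem heat_ipGen_le_prodHeat {g : V × V → ℝ} (hg : PosKernel g) {t : ℝ} (ht : 0 ≤ t)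
    (x : Fin 2 ↪ V) :
    heat (G.ipGen 2) t (fun x => g (x 0, x 1)) x ≤ prodHeat G.rwGen t g (x 0, x 1) := by
  have := nonneg_of_deriv_nonneg_at_min
    (u := fun t x => prodHeat G.rwGen t g (x 0, x 1) - heat (G.ipGen 2) t (fun x => g (x 0, x 1)) x)
    (fun t x => (hasDerivAt_prodHeat _ _ t _).sub (hasDerivAt_heat _ _ t x)) (by simp)
    (fun t ht x hx _ => by
      rw [prodGen_rwGen, ipGen_mulVec, ← edgeSum_sub]
      refine G.edgeSum_nonneg fun e => ?_
      -- Along the edge joining the particles independent walks reach (x₀,x₀) or (x₁,x₁), while the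
      -- interchange process reaches (x₁,x₀). Positivity of the form at δ_{x₀} − δ_{x₁} compares the
      -- two.
      have hU := (hg.posKernel_prodHeat G.rwGen t).sub_apply_nonneg (x 0) (x 1)
      have hm := hx (moveTuple e x)
      simp only [moveTuple_apply] at hm ⊢
      rcases edgeSwap_cases e (x.injective.ne (by decide : (0 : Fin 2) ≠ 1)) with
        ⟨h0, h1, -⟩ | h | h
      · rw [h0, h1] at hm ⊢
        linarith
      · rw [h] at hm ⊢
        linarith
      · rw [h] at hm ⊢
        linarith) ht x
  linarith

/-- The interchange process and independent walks can only differ after the walks meet. -/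
theorem prodHeat_sub_meetProb_le {g : V × V → ℝ} (g0 : ∀ p, 0 ≤ g p) (g1 : ∀ p, g p ≤ 1) {t : ℝ}
    (ht : 0 ≤ t) (x : Fin 2 ↪ V) :
    prodHeat G.rwGen t g (x 0, x 1) - meetProb G.rwGen t (x 0, x 1) ≤
      heat (G.ipGen 2) t (fun x => g (x 0, x 1)) x := by
  have hne : ∀ x : Fin 2 ↪ V, x 0 ≠ x 1 := fun x => x.injective.ne (by decide)
  have := nonneg_of_deriv_nonneg_at_min
    (u := fun t x => heat (G.ipGen 2) t (fun x => g (x 0, x 1)) x -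
      (prodHeat G.rwGen t g (x 0, x 1) - meetProb G.rwGen t (x 0, x 1)))
    (fun t x => (hasDerivAt_heat _ _ t x).sub
      ((hasDerivAt_prodHeat _ _ t _).sub (hasDerivAt_meetProb _ t _)))
    (fun x => by simp [meetProb_zero, hne x])
    (fun t ht x hx hneg => by
      rw [absorbGen_mulVec _ _ (hne x), prodGen_rwGen, prodGen_rwGen, ipGen_mulVec, ← edgeSum_sub,
        ← edgeSum_sub]
      refine G.edgeSum_nonneg fun e => ?_
      have hm := hx (moveTuple e x)
      have hH := fun x => (G.minPrinciple_ipGen 2).le_heat (c := 0)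
        (g := fun x : Fin 2 ↪ V => g (x 0, x 1)) (fun x => g0 _) ht x
      have hHx := hH x
      have hHe := hH (moveTuple e x)
      have hU := G.minPrinciple_rwGen.prodHeat_le g1 ht
      simp only [moveTuple_apply] at hm ⊢
      rcases edgeSwap_cases e (hne x) with ⟨h0, h1, -⟩ | h | h
      -- On the diagonal U − m ≤ 0, as m = 1 there. Together with H ≥ 0 at both states and H < U − m
      -- at the negative minimum, this gives the sign.
      · have hU0 := hU (x 0, x 0)
        have hU1 := hU (x 1, x 1)
        rw [h0, h1, meetProb_diag, meetProb_diag]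
        linarith
      · rw [h] at hm ⊢
        linarith
      · rw [h] at hm ⊢
        linarith) ht x
  linarith

/-- Interchange processes whose starting points differ in one coordinate can be coupled so that
they agree once two independent walks started from the differing coordinates meet. -/
theorem heat_ipGen_sub_le_of_triple {g : (Fin 2 ↪ V) → ℝ} (g0 : ∀ x, 0 ≤ g x) (g1 : ∀ x, g x ≤ 1)
    {t : ℝ} (ht : 0 ≤ t) (j j' : Fin 2 ↪ Fin 3) (hj : ∀ i, j' i = Equiv.swap 0 1 (j i))
    (x : Fin 3 ↪ V) :
    heat (G.ipGen 2) t g (j.trans x) - heat (G.ipGen 2) t g (j'.trans x) ≤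
      1 - meetProb G.rwGen t (x 0, x 1) := by
  have hne : ∀ x : Fin 3 ↪ V, x 0 ≠ x 1 := fun x => x.injective.ne (by decide)
  have := nonneg_of_deriv_nonneg_at_min
    (u := fun t (x : Fin 3 ↪ V) => 1 - meetProb G.rwGen t (x 0, x 1) -
      (heat (G.ipGen 2) t g (j.trans x) - heat (G.ipGen 2) t g (j'.trans x)))
    (fun t x => ((hasDerivAt_meetProb _ t _).const_sub 1).sub
      ((hasDerivAt_heat _ _ t (j.trans x)).sub (hasDerivAt_heat _ _ t (j'.trans x))))
    (fun x => by
      simp only [meetProb_zero, hne x, heat_zero, if_false]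
      linarith [g0 (j'.trans x), g1 (j.trans x)])
    (fun t ht x hx hneg => by
      rw [absorbGen_mulVec _ _ (hne x), prodGen_rwGen, ipGen_mulVec, ipGen_mulVec, ← edgeSum_sub,
        ← edgeSum_neg, ← edgeSum_sub]
      refine G.edgeSum_nonneg fun e => ?_
      have hm := hx (moveTuple e x)
      rw [show j.trans (moveTuple e x) = moveTuple e (j.trans x) from rfl,
        show j'.trans (moveTuple e x) = moveTuple e (j'.trans x) from rfl] at hm
      simp only [moveTuple_apply] at hm ⊢
      rcases edgeSwap_cases e (hne x) with ⟨h0, h1, h2⟩ | h | h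
      -- The edge joining the differing coordinates interchanges the two pairs, so their difference
      -- changes sign while `meetProb` becomes 1. The contribution is −2u, positive since u < 0.
      · have hs : ∀ i, edgeSwap e (x i) = x (Equiv.swap 0 1 i) := by
          intro i
          fin_cases i
          · simpa using h0
          · simpa using h1
          · exact h2 _ (x.injective.ne (by decide)) (x.injective.ne (by decide))
        have e1 : moveTuple e (j.trans x) = j'.trans x := by
          ext i
          simp [hs, hj]
        have e2 : moveTuple e (j'.trans x) = j.trans x := by
          ext i
          simp [hs, hj]
        rw [e1, e2, h0, h1, meetProb_diag, meetProb_diag]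
        linarith
      · rw [h] at hm ⊢
        linarith
      · rw [h] at hm ⊢
        linarith) ht x
  linarith

end WeightedGraph

/-! ### Contraction for the interchange process -/

/-- The ordered pair of two distinct elements. -/
def pairEmbedding {V : Type*} (a b : V) (h : a ≠ b) : Fin 2 ↪ V where
  toFun := ![a, b]
  inj' := fun i j hij => by
    fin_cases i <;> fin_cases j <;> simp_all [eq_comm]

@[simp] theorem pairEmbedding_zero {V : Type*} (a b : V) (h : a ≠ b) :
    pairEmbedding a b h 0 = a := rfl

@[simp] theorem pairEmbedding_one {V : Type*} (a b : V) (h : a ≠ b) :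
    pairEmbedding a b h 1 = b := rfl

theorem pairEmbedding_apply {V : Type*} (x : Fin 2 ↪ V) (h : x 0 ≠ x 1) :
    pairEmbedding (x 0) (x 1) h = x := by
  ext i
  fin_cases i <;> rfl

/-- The ordered triple of three distinct elements. -/
def tripleEmbedding {V : Type*} (a b c : V) (hab : a ≠ b) (hac : a ≠ c) (hbc : b ≠ c) :
    Fin 3 ↪ V where
  toFun := ![a, b, c]
  inj' := fun i j hij => by
    fin_cases i <;> fin_cases j <;> simp_all [eq_comm]

namespace WeightedGraph

variable {V : Type*} [Fintype V] [DecidableEq V] (G : WeightedGraph V)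

/-- The two pairs span a triple: its places 0 and 1 hold the differing coordinates, place 2 the
common one. -/
theorem heat_ipGen_sub_le_of_agree {g : (Fin 2 ↪ V) → ℝ} (g0 : ∀ x, 0 ≤ g x) (g1 : ∀ x, g x ≤ 1)
    {t κ : ℝ} (ht : 0 ≤ t) (hκ : ∀ p, 1 - meetProb G.rwGen t p ≤ κ) {x y : Fin 2 ↪ V}
    (h : x 0 = y 0 ∨ x 1 = y 1) :
    heat (G.ipGen 2) t g x - heat (G.ipGen 2) t g y ≤ κ := by
  have hne : ∀ x : Fin 2 ↪ V, x 0 ≠ x 1 := fun x => x.injective.ne (by decide)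
  by_cases hxy : x = y
  · have := hκ (x 0, x 0)
    rw [meetProb_diag] at this
    rw [hxy]
    linarith
  rcases h with h | h
  · have h1 : x 1 ≠ y 1 := fun h1 => hxy (by ext i; fin_cases i; exacts [h, h1])
    set z := tripleEmbedding (x 1) (y 1) (x 0) h1 (hne x).symm (h ▸ (hne y).symm)
    set j : Fin 2 ↪ Fin 3 := ⟨![2, 0], by decide⟩
    set j' : Fin 2 ↪ Fin 3 := ⟨![2, 1], by decide⟩
    have hx : j.trans z = x := by ext i; fin_cases i <;> rfl
    have hy : j'.trans z = y := by ext i; fin_cases i; exacts [h, rfl]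
    have := G.heat_ipGen_sub_le_of_triple g0 g1 ht j j' (by decide) z
    rw [hx, hy] at this
    exact this.trans (hκ _)
  · have h1 : x 0 ≠ y 0 := fun h1 => hxy (by ext i; fin_cases i; exacts [h1, h])
    set z := tripleEmbedding (x 0) (y 0) (x 1) h1 (hne x) (h ▸ hne y)
    set j : Fin 2 ↪ Fin 3 := ⟨![0, 2], by decide⟩
    set j' : Fin 2 ↪ Fin 3 := ⟨![1, 2], by decide⟩
    have hx : j.trans z = x := by ext i; fin_cases i <;> rfl
    have hy : j'.trans z = y := by ext i; fin_cases i; exacts [rfl, h]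
    have := G.heat_ipGen_sub_le_of_triple g0 g1 ht j j' (by decide) z
    rw [hx, hy] at this
    exact this.trans (hκ _)

/-- Replacing coordinates one at a time takes two changes, unless the target's second coordinate
occupies the first place of the source. A third vertex then serves as a detour, making three. -/
theorem oscContracts_ipGen_of_meetProb (hV : 2 < Fintype.card V) {t κ : ℝ} (ht : 0 ≤ t)
    (hκ : ∀ p, 1 - meetProb G.rwGen t p ≤ κ) : OscContracts (G.ipGen 2) t (3 * κ) := by
  intro g g0 g1 x y
  have hne : ∀ x : Fin 2 ↪ V, x 0 ≠ x 1 := fun x => x.injective.ne (by decide)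
  have hκ0 : 0 ≤ κ := by
    have := hκ (x 0, x 0)
    rw [meetProb_diag] at this
    linarith
  have step : ∀ x y : Fin 2 ↪ V, x 0 = y 0 ∨ x 1 = y 1 →
      heat (G.ipGen 2) t g x - heat (G.ipGen 2) t g y ≤ κ :=
    fun x y h => G.heat_ipGen_sub_le_of_agree g0 g1 ht hκ h
  have step2 : ∀ x y : Fin 2 ↪ V, y 1 ≠ x 0 →
      heat (G.ipGen 2) t g x - heat (G.ipGen 2) t g y ≤ 2 * κ := fun x y h => by
    have h1 := step x (pairEmbedding (x 0) (y 1) h.symm) (.inl rfl)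
    have h2 := step (pairEmbedding (x 0) (y 1) h.symm) y (.inr rfl)
    linarith
  by_cases h : y 1 = x 0
  · obtain ⟨c, -, hc⟩ : ∃ c ∈ Finset.univ, c ∉ ({x 0, x 1} : Finset V) :=
      Finset.exists_mem_notMem_of_card_lt_card (lt_of_le_of_lt Finset.card_le_two hV)
    simp only [Finset.mem_insert, Finset.mem_singleton, not_or] at hc
    have h1 := step x (pairEmbedding c (x 1) hc.2) (.inr rfl)
    have h2 := step2 (pairEmbedding c (x 1) hc.2) y (by rw [h]; exact Ne.symm hc.1)
    linarith
  · linarith [step2 x y h]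

/-- With at most two vertices the first coordinate determines the pair, and it performs the random
walk. -/
theorem oscContracts_ipGen_of_card_le_two (hV : Fintype.card V ≤ 2) {t c : ℝ} (ht : 0 ≤ t)
    (h : OscContracts G.rwGen t c) : OscContracts (G.ipGen 2) t c := by
  intro g g0 g1 x y
  have hinj : Function.Injective fun x : Fin 2 ↪ V => x 0 := by
    intro x y (hxy : x 0 = y 0)
    ext i
    fin_cases i
    · exact hxy
    · by_contra hne
      change x 1 ≠ y 1 at hne
      have h1 := Finset.card_eq_three.2 ⟨x 0, x 1, y 1, x.injective.ne (by decide),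
        by rw [hxy]; exact y.injective.ne (by decide), hne, rfl⟩
      have h2 := Finset.card_le_univ ({x 0, x 1, y 1} : Finset V)
      omega
  set f : V → ℝ := Function.extend (fun x : Fin 2 ↪ V => x 0) g 0 with hf
  have hfg : f ∘ (fun x : Fin 2 ↪ V => x 0) = g := by
    ext x
    exact hinj.extend_apply g 0 x
  have hf01 : ∀ v, 0 ≤ f v ∧ f v ≤ 1 := by
    intro v
    by_cases hv : ∃ x : Fin 2 ↪ V, x 0 = v
    · obtain ⟨x, rfl⟩ := hv
      rw [hf, hinj.extend_apply g 0 x]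
      exact ⟨g0 x, g1 x⟩
    · rw [hf, Function.extend_apply' _ _ _ hv]
      simp
  have hcomp := fun x => (G.minPrinciple_ipGen 2).heat_comp (M' := G.rwGen) (fun x => x 0)
    (fun g x => by rw [ipGen_mulVec, rwGen_mulVec]; rfl) f ht x
  rw [hfg] at hcomp
  rw [hcomp, hcomp]
  exact h f (fun v => (hf01 v).1) (fun v => (hf01 v).2) _ _

/-- In the second period the process loses at most `meetProb` against independent walks; Liggett's
inequality bounds the mean of that loss over the first period by `b`. -/
theorem le_heat_ipGen_of_le_prodHeat {g : V × V → ℝ} (g0 : ∀ p, 0 ≤ g p) (g1 : ∀ p, g p ≤ 1)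
    {t a b : ℝ} (ht : 0 ≤ t) (ha : ∀ p, a ≤ prodHeat G.rwGen t g p)
    (hb : ∀ p, prodHeat G.rwGen t (meetProb G.rwGen t) p ≤ b) (x : Fin 2 ↪ V) :
    a - b ≤ heat (G.ipGen 2) (t + t) (fun x => g (x 0, x 1)) x := by
  rw [heat_add_time]
  have h1 := (G.minPrinciple_ipGen 2).heat_mono
    (g := fun x => a - meetProb G.rwGen t (x 0, x 1))
    (h := heat (G.ipGen 2) t fun x => g (x 0, x 1)) (fun x => by
      linarith [G.prodHeat_sub_meetProb_le g0 g1 ht x, ha (x 0, x 1)]) ht x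
  rw [(G.minPrinciple_ipGen 2).heat_const_sub _ _ ht] at h1
  have h2 := G.heat_ipGen_le_prodHeat (G.minPrinciple_rwGen.posKernel_meetProb ht) ht x
  linarith [hb (x 0, x 1)]

theorem oscContracts_ipGen_of_prodHeat_meetProb {t b ε : ℝ} (ht : 0 ≤ t)
    (hε : OscContracts G.rwGen t ε)
    (hb : ∀ p, prodHeat G.rwGen t (meetProb G.rwGen t) p ≤ b) :
    OscContracts (G.ipGen 2) (t + t) (1 / 2 + 2 * ε + b) := by
  have hM := G.minPrinciple_rwGen
  refine OscContracts.of_lower_bound (G.minPrinciple_ipGen 2) (by linarith) fun g g0 g1 => ?_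
  -- Any value in [0,1] would serve on the diagonal.
  set f : V × V → ℝ := fun p => if h : p.1 = p.2 then 1 / 2 else g (pairEmbedding p.1 p.2 h)
    with hf
  have f01 : ∀ p, 0 ≤ f p ∧ f p ≤ 1 := by
    intro p
    simp only [hf]
    split_ifs
    · norm_num
    · exact ⟨g0 _, g1 _⟩
  have hfg : ∀ x : Fin 2 ↪ V, f (x 0, x 1) = g x := by
    intro x
    have hne : x 0 ≠ x 1 := x.injective.ne (by decide)
    simp only [hf, dif_neg hne, pairEmbedding_apply]
  have hosc := hε.prodHeat_sub_le hM ht (fun p => (f01 p).1) (fun p => (f01 p).2)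
  by_cases hp : ∃ p, 1 / 2 ≤ prodHeat G.rwGen t f p
  · obtain ⟨p, hp⟩ := hp
    refine .inl fun x => ?_
    have := G.le_heat_ipGen_of_le_prodHeat (fun p => (f01 p).1) (fun p => (f01 p).2) ht
      (a := 1 / 2 - 2 * ε) (fun q => by linarith [hosc p q]) hb x
    simp only [hfg] at this
    linarith
  · push Not at hp
    refine .inr fun x => ?_
    have hε0 : 0 ≤ ε := by simpa using hε 0 (by simp) (by simp) (x 0) (x 0)
    have := G.le_heat_ipGen_of_le_prodHeat (g := fun p => 1 - f p)
      (fun p => by linarith [(f01 p).2]) (fun p => by linarith [(f01 p).1]) ht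
      (a := 1 / 2) (fun q => by
        rw [hM.prodHeat_const_sub _ _ ht]
        linarith [hp q]) hb x
    simp only [hfg] at this
    linarith

/-- If the random walk contracts oscillations by `1/2` in time `t`, then the two-particle
interchange process contracts them by `1/4` within a bounded multiple of `t`. -/
theorem exists_oscContracts_ipGen {t : ℝ} (ht : 0 ≤ t) (h : OscContracts G.rwGen t (1 / 2)) :
    ∃ n : ℕ, n ≤ 20000 ∧ OscContracts (G.ipGen 2) (n * t) (1 / 4) := by
  have hM := G.minPrinciple_rwGen
  have hMI := G.minPrinciple_ipGen 2
  rcases le_or_gt (Fintype.card V) 2 with hV | hV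
  · refine ⟨2, by norm_num, ?_⟩
    exact (G.oscContracts_ipGen_of_card_le_two hV (by positivity) (h.pow hM ht 2)).mono
      (by norm_num)
  set τ : ℝ := (6 : ℕ) * t with hτ
  have hτ0 : 0 ≤ τ := by positivity
  have hc : OscContracts G.rwGen τ (1 / 64) := (h.pow hM ht 6).mono (by norm_num)
  by_cases hp : ∃ p, 2 / 5 ≤ prodHeat G.rwGen τ (meetProb G.rwGen τ) p
  · obtain ⟨p, hp⟩ := hp
    have hmeet : ∀ q, 1 - meetProb G.rwGen (τ + τ) q ≤ 101 / 160 := by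
      intro q
      have h1 := hc.prodHeat_sub_le hM hτ0 (hM.meetProb_nonneg hτ0) (hM.meetProb_le_one hτ0) p q
      have h2 := hM.prodHeat_meetProb_le hτ0 hτ0 q
      linarith
    -- Here 101/160 = 1 − (2/5 − 2/64) and 3·(101/160)⁶ < 1/4. Six periods of 2τ = 12t make 72t.
    refine ⟨72, by norm_num, ?_⟩
    have := (G.oscContracts_ipGen_of_meetProb hV (by positivity)
      (hM.one_sub_meetProb_mul_le (by positivity) hmeet 6)).mono (d := 1 / 4) (by norm_num)
    convert this using 1
    rw [hτ]
    push_cast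
    ring
  · push Not at hp
    -- The factor is 1/2 + 2/64 + 2/5 = 149/160, and (149/160)²⁰ < 1/4. Twenty periods of 2τ make
    -- 240t.
    refine ⟨240, by norm_num, ?_⟩
    have := ((G.oscContracts_ipGen_of_prodHeat_meetProb hτ0 hc fun p => (hp p).le).pow hMI
      (by positivity) 20).mono (d := 1 / 4) (by norm_num)
    convert this using 1
    rw [hτ]
    push_cast
    ring

/-! ### Ergodicity of the random walk -/

/-- The lower bound is exp(−dt), with d the total edge weight: the chance that no edge has rung. -/
theorem heat_single_self_pos (v : V) {t : ℝ} (ht : 0 ≤ t) :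
    0 < heat G.rwGen t (Pi.single v 1) v := by
  set d := G.edgeSum fun _ => 1 with hd
  have hM := G.minPrinciple_rwGen
  have h0 : ∀ x, (0 : ℝ) ≤ Pi.single (M := fun _ => ℝ) v 1 x := fun x => by
    by_cases hx : x = v
    · subst hx; simp
    · simp [hx]
  have := nonneg_of_deriv_nonneg_at_min
    (u := fun t (_ : Unit) => heat G.rwGen t (Pi.single v 1) v - Real.exp (-(d * t)))
    (u' := fun t (_ : Unit) => G.rwGen.mulVec (heat G.rwGen t (Pi.single v 1)) v -
      Real.exp (-(d * t)) * -(d * 1))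
    (fun t _ => (hasDerivAt_heat _ _ t v).sub (((hasDerivAt_id t).const_mul d).neg.exp))
    (by simp) (fun t ht _ _ hneg => by
      have h1 : d * heat G.rwGen t (Pi.single v 1) v =
          G.edgeSum fun _ => heat G.rwGen t (Pi.single v 1) v := by
        simp [hd, edgeSum, Finset.sum_mul]
      have h2 : 0 ≤ d := G.edgeSum_nonneg fun _ => zero_le_one
      have h3 : 0 ≤ G.edgeSum fun e => heat G.rwGen t (Pi.single v 1) (edgeSwap e v) :=
        G.edgeSum_nonneg fun e => hM.le_heat h0 ht _
      rw [rwGen_mulVec, edgeSum_sub, ← h1]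
      nlinarith) ht ()
  linarith [Real.exp_pos (-(d * t))]

theorem heat_single_pos (hG : G.graph.Connected) (v x : V) {t : ℝ} (ht : 0 < t) :
    0 < heat G.rwGen t (Pi.single v 1) x := by
  have hM := G.minPrinciple_rwGen
  have h0 : ∀ x, (0 : ℝ) ≤ Pi.single (M := fun _ => ℝ) v 1 x := fun x => by
    by_cases hx : x = v
    · subst hx; simp
    · simp [hx]
  by_contra hneg
  have key : ∀ x y, G.graph.Adj x y → heat G.rwGen t (Pi.single v 1) x = 0 →
      heat G.rwGen t (Pi.single v 1) y = 0 := by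
    intro x y hxy hx
    -- A zero at a positive time is a minimum in time, so the derivative vanishes there. It is a
    -- positively weighted sum of nonnegative neighbouring values, so zeros spread along edges,
    -- eventually to `v`.
    have hmin : IsLocalMin (fun r => heat G.rwGen r (Pi.single v 1) x) t := by
      filter_upwards [lt_mem_nhds ht] with r hr
      rw [hx]
      exact hM.le_heat h0 hr.le x
    have h1 := hmin.hasDerivAt_eq_zero (hasDerivAt_heat _ _ t x)
    rw [rwGen_mulVec] at h1
    have h2 := G.eq_zero_of_edgeSum_eq_zero (fun e => by
      rw [hx, sub_zero]; exact hM.le_heat h0 ht.le _) h1 (e := s(x, y)) hxy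
    rw [hx, sub_zero] at h2
    have h3 : edgeSwap s(x, y) x = y := Equiv.swap_apply_left x y
    rwa [h3] at h2
  have hx : heat G.rwGen t (Pi.single v 1) x = 0 :=
    le_antisymm (not_lt.1 hneg) (hM.le_heat h0 ht.le x)
  obtain ⟨w⟩ := hG.preconnected x v
  have hv : heat G.rwGen t (Pi.single v 1) v = 0 := by
    clear hneg
    have hw : ∀ {a b : V}, G.graph.Walk a b → heat G.rwGen t (Pi.single v 1) a = 0 →
        heat G.rwGen t (Pi.single v 1) b = 0 := by
      intro a b w
      induction w with
      | nil => exact id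
      | cons hab _ ih => exact fun ha => ih (key _ _ hab ha)
    exact hw w hx
  exact (G.heat_single_self_pos v ht.le).ne' hv

/-- Doeblin minorization: every point reaches `v` by time 1 with chance at least c > 0, and one of
`g`, `1 - g` is at least 1/2 at `v`. -/
theorem exists_oscContracts_rwGen (hG : G.graph.Connected) {ε : ℝ} (hε : 0 < ε) :
    ∃ t : ℝ≥0, OscContracts G.rwGen t ε := by
  have hM := G.minPrinciple_rwGen
  obtain ⟨v⟩ := hG.nonempty
  have : Nonempty V := ⟨v⟩
  obtain ⟨z, hz⟩ := Finite.exists_min (heat G.rwGen 1 (Pi.single v 1))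
  set c := heat G.rwGen 1 (Pi.single v 1) z with hc
  have hc0 : 0 < c := G.heat_single_pos hG v z one_pos
  have hlow : ∀ g : V → ℝ, (∀ s, 0 ≤ g s) → 1 / 2 ≤ g v → ∀ x,
      1 - (1 - 1 / 2 * c) ≤ heat G.rwGen 1 g x := by
    intro g g0 gv x
    have h1 := hM.heat_mono (g := (1 / 2 : ℝ) • Pi.single v 1) (h := g) (fun s => by
      by_cases hs : s = v
      · subst hs; simpa using gv
      · simpa [hs] using g0 s) zero_le_one x
    rw [heat_smul, Pi.smul_apply, smul_eq_mul] at h1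
    linarith [hz x]
  have hcontr : OscContracts G.rwGen 1 (1 - 1 / 2 * c) := by
    refine OscContracts.of_lower_bound hM zero_le_one fun g g0 g1 => ?_
    rcases le_total (1 / 2) (g v) with h | h
    · exact .inl (hlow g g0 h)
    · exact .inr (hlow _ (fun s => by linarith [g1 s]) (by linarith))
  obtain ⟨n, hn⟩ := exists_pow_lt_of_lt_one hε (show 1 - 1 / 2 * c < 1 by linarith)
  refine ⟨n, ?_⟩
  have := (hcontr.pow hM zero_le_one n).mono hn.le
  simpa using this

end WeightedGraph

/-! ### Comparison of mixing times -/

theorem lemma2 {V : Type*} [Fintype V] [DecidableEq V] (G : WeightedGraph V)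
    (hG : G.graph.Connected)
    (π : V → ℝ) (hπ : IsStationaryDist G.rwRate π)
    (ρ : (Fin 2 ↪ V) → ℝ) (hρ : IsStationaryDist (G.ipRate 2) ρ) :
    mixingTime G.rwRate π (1 / 4) < ∞ ∧
      mixingTime (G.ipRate 2) ρ (1 / 4) ≤ 20000 * mixingTime G.rwRate π (1 / 4) := by
  refine ⟨?_, ?_⟩
  · obtain ⟨t, ht⟩ := G.exists_oscContracts_rwGen hG (ε := 1 / 4) (by norm_num)
    exact lt_of_le_of_lt (ht.mixingTime_le hπ) ENNReal.coe_lt_top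
  -- Dividing by 20000 turns the claim into a lower bound for an infimum, checked at each admissible
  -- `t`; the infimum need not be attained.
  · rw [mul_comm, ← ENNReal.div_le_iff_le_mul (by simp) (by simp)]
    refine le_iInf₂ fun t ht => ?_
    rw [ENNReal.div_le_iff_le_mul (by simp) (by simp), mul_comm]
    have h1 := (OscContracts.of_tvDist G.minPrinciple_rwGen hπ.sum_eq_one ht).mono
      (d := 1 / 2) (by norm_num)
    obtain ⟨n, hn, h2⟩ := G.exists_oscContracts_ipGen t.2 h1
    have h3 : OscContracts (generator (G.ipRate 2)) ((n * t : ℝ≥0) : ℝ) (1 / 4) := by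
      push_cast
      exact h2
    refine (h3.mixingTime_le hρ).trans ?_
    rw [ENNReal.coe_mul]
    gcongr
    exact_mod_cast hn
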